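/- Let $S$ be a smooth irreducible curve over $\mathbb{C}$ (separated and of finite type), let $\pi:\mathcal{A}\to S$ be an abelian scheme (a smooth proper group scheme over $S$ with geometrically connected fibers), and let $\mathcal{C}\subseteq\mathcal{A}$ be an irreducible curve (an integral, locally closed, for instance closed, subscheme of dimension $1$) that is not contained in any fiber of $\pi$. For a closed point $s\in S$ let $\mathcal{A}_s=\pi^{-1}(s)$, and let $\mathcal{C}\cap_{\mathrm{sing}}\mathcal{A}_s$ be the set of points $p\in\mathcal{C}\cap\mathcal{A}_s$ at which the intersection multiplicity of $\mathcal{C}$ and $\mathcal{A}_s$, that is, the length of the local ring $\mathcal{O}_{\mathcal{C}\cap\mathcal{A}_s,p}$ of the scheme-theoretic intersection, is strictly greater than $1$. Then the set $$\mathcal{C}^{\{1,\mathrm{ram}\}}=\bigcup_{s\in S}\mathcal{C}\cap_{\mathrm{sing}}\mathcal{A}_s,$$ where $s$ runs over the closed points of $S$, is finite. -/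

import Mathlib

open AlgebraicGeometry CategoryTheory CategoryTheory.Limits

/-- The intersection multiplicity of two subschemes `i : V ⟶ X`, `j : W ⟶ X` at a point `q` of their
scheme-theoretic intersection `V ×[X] W`: the length of the local ring `𝒪_{V ∩ W, q}`.
When `W` is an effective Cartier divisor on `X` with local equation `t` and `V` is an integral curve
not contained in `W`, this is the length of `𝒪_{V, q} / (t)`, the usual intersection number. -/
noncomputable def intersectionMultiplicity {V W X : Scheme.{0}} (i : V ⟶ X) (j : W ⟶ X)
    (q : ↥(pullback i j)) : ℕ∞ :=
  Module.length ((pullback i j).presheaf.stalk q) ((pullback i j).presheaf.stalk q)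

/-- The singular intersection `V ∩_sing W`: the set of points of `X` lying on `V ∩ W` at which
the intersection multiplicity is strictly greater than `1`. -/
def singularIntersection {V W X : Scheme.{0}} (i : V ⟶ X) (j : W ⟶ X) : Set X :=
  {p | ∃ q : ↥(pullback i j), (pullback.fst i j ≫ i) q = p ∧ 1 < intersectionMultiplicity i j q}

universe u

/-! The intersection of `C` with the fibre over `s` is the scheme-theoretic fibre over `s` of `g = i
≫ π : C ⟶ S`. Where `g` is unramified, the local rings of this fibre are fields, so the multiplicity
is 1 (`isField_stalk_pullback_fiberι`). Since `C` lies in no fibre, `g` does not send the generic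
point to a closed point, and in characteristic zero it is then unramified on a nonempty open set
(`exists_formallyUnramified_of_notMem_closedPoints`). The complement of that set is finite because
`C` is a noetherian curve. -/

/-- A domain of finite type over a field `k`, of dimension at most one, is algebraic over every
`k`-subalgebra that is not algebraic over `k`. -/
theorem Algebra.IsAlgebraic.of_finiteType_of_krullDimLE_one (k : Type*) {R B : Type u} [Field k]
    [CommRing B] [IsDomain B] [Ring.KrullDimLE 1 B] [Algebra k B] [Algebra.FiniteType k B]
    [CommRing R] [Algebra k R] [Algebra R B] [IsScalarTower k R B]
    [FaithfulSMul R B] {t : R} (ht : Transcendental k t) :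
    Algebra.IsAlgebraic R B := by
  have hinj : Function.Injective (algebraMap R B) := FaithfulSMul.algebraMap_injective R B
  have : IsDomain R := hinj.isDomain
  have : Algebra.FiniteType R B := .of_restrictScalars_finiteType k R B
  let M := Algebra.algebraMapSubmonoid B (nonZeroDivisors R)
  have hM : M ≤ nonZeroDivisors B := by
    simpa [M, Algebra.algebraMapSubmonoid] using
      map_le_nonZeroDivisors_of_injective (algebraMap R B) hinj le_rfl
  let L := Localization M
  let F := FractionRing R
  have : IsDomain L := IsLocalization.isDomain_localization hM
  have : Algebra.FiniteType F L := by
    have : IsLocalization ((nonZeroDivisors R).map (algebraMap R B)) L :=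
      inferInstanceAs (IsLocalization M L)
    have h : (algebraMap F L).FiniteType :=
      RingHom.finiteType_localizationPreserves (algebraMap R B) (nonZeroDivisors R) F L
        (RingHom.finiteType_algebraMap.mpr ‹_›)
    exact RingHom.finiteType_algebraMap.mp h
  -- A nonzero prime of `L` would contract to a maximal ideal of `B` with residue field finite over
  -- `k`. That ideal contains some nonzero `q(t)` with `q` over `k`, which is a unit in `L`.
  have hL : IsField L := by
    by_contra hL
    obtain ⟨P, hP0, hP⟩ := Ring.not_isField_iff_exists_prime.mp hL
    have hp : (P.under B).IsPrime := inferInstance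
    have hp0 : P.under B ≠ ⊥ := by
      intro h
      apply hP0
      rw [← IsLocalization.map_under M L P, h, Ideal.map_bot]
    have : (P.under B).IsMaximal := hp.isMaximal_of_ne_bot hp0
    let := Ideal.Quotient.field (P.under B)
    have : Module.Finite k (B ⧸ P.under B) := finite_of_finite_type_of_isJacobsonRing _ _
    obtain ⟨q, hq0, hq⟩ := Algebra.IsAlgebraic.isAlgebraic (R := k)
      (Ideal.Quotient.mk (P.under B) (algebraMap R B t))
    have h1 : algebraMap R B (Polynomial.aeval t q) ∈ P.under B := by
      rw [← Ideal.Quotient.eq_zero_iff_mem, ← Polynomial.aeval_algebraMap_apply, ← hq]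
      exact (Polynomial.aeval_algHom_apply (Ideal.Quotient.mkₐ k (P.under B)) _ q).symm
    have h2 : Polynomial.aeval t q ≠ 0 := fun h ↦ ht ⟨q, hq0, h⟩
    have h3 : IsUnit (algebraMap B L (algebraMap R B (Polynomial.aeval t q))) :=
      IsLocalization.map_units L
        (⟨_, Algebra.mem_algebraMapSubmonoid_of_mem
          (⟨_, mem_nonZeroDivisors_of_ne_zero h2⟩ : nonZeroDivisors R)⟩ : M)
    exact hP.ne_top (Ideal.eq_top_of_isUnit_mem _ h1 h3)
  let := hL.toField
  have : Module.Finite F L := finite_of_finite_type_of_isJacobsonRing F L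
  have : Algebra.IsAlgebraic F L := inferInstance
  have : Algebra.IsAlgebraic R L := (IsFractionRing.comap_isAlgebraic_iff (K := F)).mpr this
  exact .of_injective (IsScalarTower.toAlgHom R B L) (IsLocalization.injective L hM)

/-- In characteristic zero, an algebraic extension of domains is unramified at the generic point. -/
theorem Algebra.IsAlgebraic.isUnramifiedAt_bot (R B : Type*) [CommRing R] [CommRing B] [IsDomain B]
    [Algebra R B] [FaithfulSMul R B] [CharZero R] [Algebra.IsAlgebraic R B] :
    Algebra.IsUnramifiedAt R (⊥ : Ideal B) := by
  have : IsDomain R := (FaithfulSMul.algebraMap_injective R B).isDomain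
  have : IsFractionRing B (Localization.AtPrime (⊥ : Ideal B)) := by
    simpa [Ideal.primeCompl_bot] using Localization.isLocalization (M := (⊥ : Ideal B).primeCompl)
  let : Field (Localization.AtPrime (⊥ : Ideal B)) := IsFractionRing.toField B
  have : FaithfulSMul R (Localization.AtPrime (⊥ : Ideal B)) := by
    rw [faithfulSMul_iff_algebraMap_injective,
      IsScalarTower.algebraMap_eq R B (Localization.AtPrime ⊥)]
    exact (IsFractionRing.injective B _).comp (FaithfulSMul.algebraMap_injective R B)
  let := FractionRing.liftAlgebra R (Localization.AtPrime (⊥ : Ideal B))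
  have : Algebra.IsAlgebraic (FractionRing R) (Localization.AtPrime ⊥) :=
    have : Algebra.IsAlgebraic B (Localization.AtPrime (⊥ : Ideal B)) :=
      IsLocalization.isAlgebraic _ (nonZeroDivisors B)
    have : Algebra.IsAlgebraic R (Localization.AtPrime (⊥ : Ideal B)) := .trans R B _
    (IsFractionRing.comap_isAlgebraic_iff (K := FractionRing R)).mp this
  -- Factor through `Frac R`: a localization, then an extension that is separable by characteristic
  -- zero.
  have : Algebra.FormallyUnramified R (FractionRing R) := .of_isLocalization (nonZeroDivisors R)
  have : Algebra.FormallyUnramified (FractionRing R) (Localization.AtPrime (⊥ : Ideal B)) :=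
    .of_isSeparable _ _
  exact Algebra.FormallyUnramified.comp R (FractionRing R) (Localization.AtPrime ⊥)

/-- A prime of an unramified algebra is maximal if it lies over a maximal ideal. -/
theorem Ideal.IsPrime.isMaximal_of_formallyUnramified {R B : Type*} [CommRing R] [CommRing B]
    [Algebra R B] [Algebra.FormallyUnramified R B] [Algebra.EssFiniteType R B] {p : Ideal B}
    (hp : p.IsPrime) (h : (p.under R).IsMaximal) : p.IsMaximal := by
  let := Ideal.Quotient.field (p.under R)
  have : Algebra.FormallyUnramified R (B ⧸ p) := inferInstance
  have : Algebra.FormallyUnramified (R ⧸ p.under R) (B ⧸ p) := .of_restrictScalars R _ _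
  have : Algebra.EssFiniteType R (B ⧸ p) := .comp R B _
  have : Algebra.EssFiniteType (R ⧸ p.under R) (B ⧸ p) := .of_comp R _ _
  have : Module.Finite (R ⧸ p.under R) (B ⧸ p) := Algebra.FormallyUnramified.finite_of_free _ _
  exact Ideal.Quotient.maximal_of_isField _
    (isField_of_isIntegral_of_isField' (R := R ⧸ p.under R) (Field.toIsField _))

open Polynomial in
/-- Let `R` be standard smooth of relative dimension one over a field `k` of characteristic zero
and `B` a domain of finite type over `k`, of dimension at most one. If the kernel of `R → B` is not
maximal, then `R → B` is generically unramified. -/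
theorem RingHom.exists_formallyUnramified_away {k R B : Type u} [Field k] [CharZero k]
    [CommRing R] [CommRing B] [IsDomain B] [Ring.KrullDimLE 1 B] {ψ : k →+* R} {φ : R →+* B}
    (hψ : ψ.IsStandardSmoothOfRelativeDimension 1) (hφ : (φ.comp ψ).FiniteType)
    (hker : ¬ (RingHom.ker φ).IsMaximal) :
    ∃ r : B, r ≠ 0 ∧ ((algebraMap B (Localization.Away r)).comp φ).FormallyUnramified := by
  algebraize [ψ, φ, φ.comp ψ]
  -- An étale coordinate `k[X] → R` reduces the question to whether `X` stays transcendental over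
  -- `k` in `B`.
  obtain ⟨g, hg⟩ := Algebra.IsStandardSmoothOfRelativeDimension.exists_etale_mvPolynomial 1 k R
  let θ : k[X] →ₐ[k] R := g.comp (MvPolynomial.uniqueAlgEquiv k (Fin 1)).symm.toAlgHom
  have hθ : (θ : k[X] →+* R).FormallyUnramified :=
    .comp (.of_surjective (MvPolynomial.uniqueAlgEquiv k (Fin 1)).symm.surjective)
      hg.formallyUnramified
  algebraize [(θ : k[X] →+* R), φ.comp (θ : k[X] →+* R)]
  have : IsScalarTower k k[X] R := .of_algebraMap_eq' θ.comp_algebraMap.symm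
  have : IsScalarTower k k[X] B := .to₁₂₄ _ _ R _
  have : Algebra.EssFiniteType k R :=
    have : Algebra.IsStandardSmooth k R :=
      Algebra.IsStandardSmoothOfRelativeDimension.isStandardSmooth 1
    have : Algebra.FinitePresentation k R := Algebra.IsStandardSmooth.finitePresentation
    inferInstance
  have : Algebra.EssFiniteType k[X] R := .of_comp k _ _
  have : Algebra.EssFiniteType R B := .of_comp k _ _
  by_cases hinj : Function.Injective (algebraMap k[X] B)
  · have : FaithfulSMul k[X] B := (faithfulSMul_iff_algebraMap_injective _ _).mpr hinj
    have : Algebra.IsAlgebraic k[X] B :=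
      .of_finiteType_of_krullDimLE_one k (transcendental_X k)
    have := Algebra.IsAlgebraic.isUnramifiedAt_bot k[X] B
    have : Algebra.IsUnramifiedAt R (⊥ : Ideal B) := .of_restrictScalars k[X] _
    obtain ⟨r, hr, h⟩ := Algebra.exists_formallyUnramified_of_isUnramifiedAt (R := R) (⊥ : Ideal B)
    exact ⟨r, hr, RingHom.formallyUnramified_algebraMap.mpr h⟩
  -- Here `ker φ` contracts to a nonzero, hence maximal, ideal of `k[X]`, and `R` is unramified over
  -- `k[X]`.
  · refine absurd ?_ hker
    have hp : (RingHom.ker φ).IsPrime := RingHom.ker_isPrime φ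
    refine hp.isMaximal_of_formallyUnramified (R := k[X]) ?_
    refine Ideal.IsPrime.isMaximal inferInstance fun h ↦ hinj ?_
    rw [RingHom.injective_iff_ker_eq_bot, ← h]
    rfl

open TopologicalSpace in
/-- In a sober noetherian space of dimension at most one, a closed set that misses
a dense point is finite. -/
theorem IsClosed.finite_of_topologicalKrullDim_le_one {X : Type*} [TopologicalSpace X]
    [NoetherianSpace X] [QuasiSober X] [T0Space X]
    (hX : topologicalKrullDim X ≤ 1) {η : X} (hη : closure {η} = Set.univ) {Z : Set X}
    (hZ : IsClosed Z) (hηZ : η ∉ Z) : Z.Finite := by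
  obtain ⟨F, hF, hFc, hFi, rfl⟩ :=
    NoetherianSpace.exists_finite_set_isClosed_irreducible hZ
  refine hF.sUnion fun T hT ↦ Set.Subsingleton.finite ?_
  obtain ⟨x, hx⟩ := QuasiSober.sober (hFi T hT) (hFc T hT)
  -- A second point `y` of `T` would give a chain of length 2: the closures of `y`, `x` and `η`.
  suffices h : ∀ y ∈ T, y = x from fun y hy z hz ↦ (h y hy).trans (h z hz).symm
  intro y hy
  by_contra hyx
  let a : IrreducibleCloseds X :=
    ⟨closure {y}, isIrreducible_singleton.closure, isClosed_closure⟩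
  let b : IrreducibleCloseds X :=
    ⟨closure {x}, isIrreducible_singleton.closure, isClosed_closure⟩
  let c : IrreducibleCloseds X :=
    ⟨closure {η}, isIrreducible_singleton.closure, isClosed_closure⟩
  have hab : a < b := by
    refine lt_of_le_of_ne ?_ fun h ↦ hyx ?_
    · exact closure_minimal
        (Set.singleton_subset_iff.mpr (hx.def.symm ▸ hy : y ∈ closure {x})) isClosed_closure
    · have h' : closure {y} = closure {x} :=
        congrArg (fun T : IrreducibleCloseds X ↦ (T : Set X)) h
      exact (inseparable_iff_closure_eq.mpr h').eq
  have hbc : b < c := by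
    refine lt_of_le_of_ne ?_ fun h ↦ ?_
    · intro z _
      exact (hη.symm ▸ Set.mem_univ z : z ∈ closure {η})
    · have h' : closure {x} = closure {η} :=
        congrArg (fun T : IrreducibleCloseds X ↦ (T : Set X)) h
      exact hηZ ⟨T, hT, hx.def ▸ h' ▸ subset_closure rfl⟩
  let s : LTSeries (IrreducibleCloseds X) :=
    ((RelSeries.singleton _ a).snoc b hab).snoc c ((RelSeries.last_snoc _ _ _).symm ▸ hbc)
  have := (Order.LTSeries.length_le_krullDim s).trans hX
  have h2 : ((2 : ℕ) : WithBot ℕ∞) ≤ (1 : ℕ) := this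
  exact absurd (Nat.cast_le.mp h2) (by norm_num)

/-- The local rings of an unramified scheme over a field are fields. -/
theorem isField_stalk_of_formallyUnramified {X : Scheme.{u}} {K : CommRingCat.{u}} (hK : IsField K)
    (h : X ⟶ Spec K) [FormallyUnramified h] [LocallyOfFiniteType h] (x : X) :
    IsField (X.presheaf.stalk x) := by
  algebraize [(h.stalkMap x).hom]
  have : Algebra.EssFiniteType ((Spec K).presheaf.stalk (h x)) (X.presheaf.stalk x) := by
    rw [← RingHom.essFiniteType_algebraMap, RingHom.algebraMap_toAlgebra]
    exact LocallyOfFiniteType.stalkMap h x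
  have : Algebra.FormallyUnramified ((Spec K).presheaf.stalk (h x)) (X.presheaf.stalk x) := by
    rw [← RingHom.formallyUnramified_algebraMap, RingHom.algebraMap_toAlgebra]
    exact FormallyUnramified.stalkMap h x
  have : IsLocalHom (algebraMap ((Spec K).presheaf.stalk (h x)) (X.presheaf.stalk x)) :=
    inferInstanceAs <| IsLocalHom (h.stalkMap x).hom
  have hK' : IsField ((Spec K).presheaf.stalk (h x)) := by
    let := hK.toField
    have : IsReduced (Spec K) := inferInstance
    have : Subsingleton (Spec K) := inferInstanceAs (Subsingleton (PrimeSpectrum K))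
    refine isField_stalk_of_closure_mem_irreducibleComponents _ _ ?_
    rw [irreducibleComponents_eq_singleton]
    simp [Set.eq_univ_iff_forall, Subsingleton.elim _ (h x)]
  rw [IsLocalRing.isField_iff_maximalIdeal_eq] at hK' ⊢
  rw [← Algebra.FormallyUnramified.map_maximalIdeal (R := (Spec K).presheaf.stalk (h x)), hK',
    Ideal.map_bot]

/-- The local rings of the scheme-theoretic intersection of `C` with a fibre of `π` are fields
over every open subscheme of `C` that is unramified over the base. -/
theorem isField_stalk_pullback_fiberι {C A S : Scheme.{u}} (i : C ⟶ A) (π : A ⟶ S) (s : S)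
    {W : Scheme.{u}} (j : W ⟶ C) [IsOpenImmersion j] [FormallyUnramified (j ≫ i ≫ π)]
    [LocallyOfFiniteType (j ≫ i ≫ π)]
    (q : ↥(pullback i (π.fiberι s))) (hq : pullback.fst i (π.fiberι s) q ∈ Set.range j) :
    IsField ((pullback i (π.fiberι s)).presheaf.stalk q) := by
  let P := pullback i (π.fiberι s)
  let h : P ⟶ Spec (S.residueField s) := pullback.snd _ _ ≫ π.fiberToSpecResidueField s
  -- Pasting the two cartesian squares identifies the intersection with the fibre of `i ≫ π` over
  -- `s`.
  have H : IsPullback (pullback.fst i (π.fiberι s)) h (i ≫ π) (S.fromSpecResidueField s) :=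
    (IsPullback.of_hasPullback i (π.fiberι s)).flip.paste_horiz
      (IsPullback.of_hasPullback π (S.fromSpecResidueField s)).flip |>.flip
  have H' := (IsPullback.of_hasPullback j (pullback.fst i (π.fiberι s))).flip.paste_horiz
    H.flip |>.flip
  let h' := pullback.snd j (pullback.fst i (π.fiberι s)) ≫ h
  have : FormallyUnramified h' := MorphismProperty.of_isPullback H' ‹_›
  have : LocallyOfFiniteType h' := MorphismProperty.of_isPullback H' ‹_›
  obtain ⟨q', rfl⟩ : q ∈ Set.range (pullback.snd j (pullback.fst i (π.fiberι s))) := by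
    rw [Scheme.Pullback.range_snd]
    exact hq
  refine MulEquiv.isField (isField_stalk_of_formallyUnramified (Field.toIsField _) h' q')
    (asIso ((pullback.snd j (pullback.fst i (π.fiberι s))).stalkMap
      q')).commRingCatIsoToRingEquiv.toMulEquiv

/-- The sections over an affine open of a scheme of dimension at most one have Krull dimension at
most one. -/
theorem AlgebraicGeometry.IsAffineOpen.krullDimLE_one {C : Scheme.{u}}
    (hC : topologicalKrullDim C ≤ 1) {W : C.Opens}
    (hW : IsAffineOpen W) : Ring.KrullDimLE 1 Γ(C, W) := by
  rw [Ring.krullDimLE_iff, ← PrimeSpectrum.topologicalKrullDim_eq_ringKrullDim]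
  exact (hW.fromSpec.isOpenEmbedding.isInducing.topologicalKrullDim_le).trans hC

/-- Let `S` be smooth of relative dimension one over a field of characteristic zero, `C` integral
of dimension at most one and `g : C ⟶ S` locally of finite type. If `g` does not map the generic
point of `C` to a closed point, then `g` is generically unramified. -/
theorem exists_formallyUnramified_of_notMem_closedPoints {k : Type u} [Field k] [CharZero k]
    {S C : Scheme.{u}} (f : S ⟶ Spec (.of k)) [SmoothOfRelativeDimension 1 f] [IsIntegral C]
    (hC : topologicalKrullDim C ≤ 1) (g : C ⟶ S) [LocallyOfFiniteType g]
    (hg : g (genericPoint C) ∉ closedPoints S) :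
    ∃ (W : Scheme.{u}) (j : W ⟶ C), IsOpenImmersion j ∧ FormallyUnramified (j ≫ g) ∧
      genericPoint C ∈ Set.range j := by
  have : Smooth f := SmoothOfRelativeDimension.smooth 1 f
  have : JacobsonSpace S := LocallyOfFiniteType.jacobsonSpace f
  obtain ⟨U, hU, V, hV, hηV, e, hfs⟩ :=
    SmoothOfRelativeDimension.exists_isStandardSmoothOfRelativeDimension (n := 1) (f := f)
      (g (genericPoint C))
  obtain rfl : U = ⊤ := by
    have : Subsingleton (Spec (.of k)) := inferInstanceAs (Subsingleton (PrimeSpectrum k))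
    ext x
    simpa [Subsingleton.elim x (f (g (genericPoint C)))] using e hηV
  let ψ : k →+* Γ(S, V) :=
    (f.appLE ⊤ V e).hom.comp (Scheme.ΓSpecIso (.of k)).symm.commRingCatIsoToRingEquiv.toRingHom
  have hψ : ψ.IsStandardSmoothOfRelativeDimension 1 :=
    RingHom.isStandardSmoothOfRelativeDimension_respectsIso.2 _ _ hfs
  obtain ⟨_, ⟨W, hW, rfl⟩, hηW, hWV : W ≤ g ⁻¹ᵁ V⟩ :=
    C.isBasis_affineOpens.exists_subset_of_mem_open (a := genericPoint C) hηV (g ⁻¹ᵁ V).isOpen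
  have hW : IsAffineOpen W := hW
  have : Nonempty W := ⟨⟨_, hηW⟩⟩
  let φ : Γ(S, V) →+* Γ(C, W) := (g.appLE V W hWV).hom
  have hφ : (φ.comp ψ).FiniteType :=
    (g.finiteType_appLE hV hW hWV).comp ((f.finiteType_appLE hU hV e).comp
      (.of_surjective _ (RingEquiv.surjective _)))
  have := IsAffineOpen.krullDimLE_one hC hW
  have hη : g (genericPoint C) =
      hV.fromSpec (Spec.map (g.appLE V W hWV) (genericPoint (Spec Γ(C, W)))) := by
    rw [← Scheme.Hom.comp_apply, IsAffineOpen.SpecMap_appLE_fromSpec _ _ hW, Scheme.Hom.comp_apply,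
      ← hW.primeIdealOf_genericPoint, hW.fromSpec_primeIdealOf]
  -- `ker φ` is the prime of the image of the generic point. As `S` is Jacobson, a point closed in
  -- `V` is closed in `S`.
  have hker : ¬ (RingHom.ker φ).IsMaximal := by
    refine fun hmax ↦ hg ?_
    rw [hη, ← Set.mem_preimage, hV.fromSpec.isOpenEmbedding.preimage_closedPoints,
      mem_closedPoints_iff, genericPoint_eq_bot_of_affine]
    exact (PrimeSpectrum.isClosed_singleton_iff_isMaximal
      (PrimeSpectrum.comap φ (⊥ : PrimeSpectrum Γ(C, W)))).mpr hmax
  obtain ⟨r, hr, h⟩ := RingHom.exists_formallyUnramified_away hψ hφ hker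
  let l : Spec (.of (Localization.Away r)) ⟶ Spec Γ(C, W) :=
    Spec.map (CommRingCat.ofHom (algebraMap Γ(C, W) (Localization.Away r)))
  have : IsOpenImmersion l := inferInstance
  refine ⟨_, l ≫ hW.fromSpec, inferInstance, ?_, ?_⟩
  · rw [Category.assoc, ← IsAffineOpen.SpecMap_appLE_fromSpec _ hV hW hWV, ← Spec.map_comp_assoc]
    have : FormallyUnramified (Spec.map
        (g.appLE V W hWV ≫ CommRingCat.ofHom (algebraMap Γ(C, W) (Localization.Away r)))) :=
      HasRingHomProperty.Spec_iff.mpr h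
    exact MorphismProperty.comp_mem _ _ _ this inferInstance
  · have : Nontrivial (Localization.Away r) :=
      (IsLocalization.injective (Localization.Away r)
        (powers_le_nonZeroDivisors_of_noZeroDivisors hr)).nontrivial
    rw [(genericPoint_spec C).mem_open_set_iff (Scheme.Hom.isOpenEmbedding _).isOpen_range]
    simpa using Set.range_nonempty _

theorem mainTheorem4
    -- `S` is a smooth irreducible curve over the complex numbers
    (S : Scheme.{0}) (f : S ⟶ Spec (CommRingCat.of ℂ))
    [SmoothOfRelativeDimension 1 f] [IsSeparated f] [QuasiCompact f] [IrreducibleSpace S]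
    -- `π : A ⟶ S` is an abelian scheme
    (A : Scheme.{0}) (π : A ⟶ S) [GrpObj (Over.mk π)]
    [IsProper π] [Smooth π] [GeometricallyConnected π]
    -- `C` is an irreducible curve in `A`
    (C : Scheme.{0}) (i : C ⟶ A) [IsImmersion i] [IsIntegral C] (hC : topologicalKrullDim C = 1)
    -- `C` is not contained in any fiber
    (hfib : ∀ s ∈ closedPoints S, ¬ Set.range i ⊆ Set.range (π.fiberι s)) :
    (⋃ s ∈ closedPoints S, singularIntersection i (π.fiberι s)).Finite := by
  have : Smooth f := SmoothOfRelativeDimension.smooth 1 f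
  have : IsLocallyNoetherian A := LocallyOfFiniteType.isLocallyNoetherian (π ≫ f)
  have : CompactSpace A := QuasiCompact.compactSpace_of_compactSpace (π ≫ f)
  have : IsNoetherian A := {}
  have : TopologicalSpace.NoetherianSpace C := i.isEmbedding.isInducing.noetherianSpace
  -- Every point of `C` specializes the generic one, so a closed image would put all of `C` in one
  -- fibre.
  have hη : (i ≫ π) (genericPoint C) ∉ closedPoints S := by
    refine fun hs ↦ hfib _ hs ?_
    rintro _ ⟨c, rfl⟩
    rw [Scheme.Hom.range_fiberι]
    have := (genericPoint_specializes c).map (i ≫ π).continuous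
    exact (mem_closedPoints_iff.mp hs).closure_eq.le (specializes_iff_mem_closure.mp this)
  obtain ⟨W, j, _, _, hj⟩ := exists_formallyUnramified_of_notMem_closedPoints f hC.le (i ≫ π) hη
  refine ((j.isOpenEmbedding.isOpen_range.isClosed_compl.finite_of_topologicalKrullDim_le_one hC.le
    (genericPoint_spec C).def (by simpa using hj)).image i).subset ?_
  simp only [Set.iUnion_subset_iff]
  rintro s - _ ⟨q, rfl, hq⟩
  refine ⟨_, fun hqj ↦ ?_, (Scheme.Hom.comp_apply _ _ _).symm⟩
  have := (isSimpleModule_iff _ _).mpr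
    (Ring.isField_iff_isSimpleOrder_ideal.mp (isField_stalk_pullback_fiberι i π s j q hqj))
  rw [intersectionMultiplicity, Module.length_eq_one_iff.mpr this] at hq
  exact lt_irrefl _ hq
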